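/- **Setting.** Let $\mathcal X$ (contexts) and $\mathcal Y$ (arms) be sets, let $D$ be a metric on $\mathcal P=\mathcal X\times\mathcal Y$ with $D\le 1$, let $d_r\ge 1$, and let $\mu_y(x)=(\mu^1_y(x),\dots,\mu^{d_r}_y(x))\in\mathbb R^{d_r}$ be the expected reward vectors, with $|\mu^i_y(x)-\mu^i_{y'}(x')|\le D((x,y),(x',y'))$ for all $i$ and all pairs. For vectors write $a\prec b$ if $a^i\le b^i$ for all $i$ and $a^i<b^i$ for some $i$. The Pareto front at $x$ is $\mathcal O(x)=\{y:\mu_y(x)\not\prec\mu_{y'}(x)\ \forall y'\in\mathcal Y\}$, and the Pareto suboptimality gap $\Delta_y(x)$ is the infimum of the $\varepsilon\ge 0$ such that $\mu_y(x)+(\varepsilon,\dots,\varepsilon)\not\prec\mu_{y'}(x)$ for all $y'\in\mathcal O(x)$. For $r>0$ let $N_r\in\mathbb N\cup\{\infty\}$ be the largest cardinality of a subset of $\{(x,y)\in\mathcal P:\Delta_y(x)\le 12r\}$ whose distinct points are at $D$-distance at least $r$. For $p>0$ the Pareto zooming dimension is $d_p=\inf\{d>0: N_r\le p\,r^{-d}\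 \forall r\in(0,1)\}\in[0,\infty]$, with $\inf\emptyset=\infty$; for $d_p=\infty$ read $\frac{1+d_p}{2+d_p}=1$. **Algorithm (Pareto Contextual Zooming).** Fix $T\ge 1$, $\delta\in(0,1)$ and $A=1+2\log(2\sqrt2\,d_rT^{3/2}/\delta)$. The algorithm keeps a finite collection $\mathcal B$ of active closed balls $B$ with center $(x_B,y_B)$, radius $r(B)$, counter $N_B$ and sample means $\hat\mu^i_B$; new balls start with $N_B=\hat\mu^i_B=0$. Initially $\mathcal B$ is a single ball with radius $1$ and arbitrary center. Put $u_B=\sqrt{2A/N_B}$ ($=\infty$ if $N_B=0$), $g^i_B=r(B)+\min_{B'\in\mathcal B}\big(\hat\mu^i_{B'}+u_{B'}+r(B')+D(B',B)\big)$, where $D(B',B)$ is the distance of the centers, and $\mathrm{dom}(B)=B\setminus\bigcup_{B'\in\mathcal B:\,r(B')<r(B)}B'$. In round $t=1,\dots,T$ a context $x_t$ is observed; a ball $B$ is relevant if $(x_t,y)\in\mathrm{dom}(B)$ for some $y$, and $\hat{\mathcal A}^*$ is the set of relevant balls $B$ with $g_B\not\prec g_{B'}$ for all relevant $B'$. An arm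 $y_t\in\{y:(x_t,y)\in\bigcup_{B\in\hat{\mathcal A}^*}\mathrm{dom}(B)\}$ and then a ball $\hat B_t\in\hat{\mathcal A}^*$ whose domain contains $(x_t,y_t)$ are selected, each uniformly at random (or by any other, possibly randomized, rule), and the reward vector $r_t=\mu_{y_t}(x_t)+\kappa_t$ is observed. If $u_{\hat B_t}\le r(\hat B_t)$, a new ball with center $(x_t,y_t)$ and radius $r(\hat B_t)/2$ is added to $\mathcal B$. Finally $r_t$ is averaged into $\hat\mu_{\hat B_t}$ and $N_{\hat B_t}$ is increased by $1$. Each noise coordinate is conditionally $1$-sub-Gaussian: for all $\lambda\in\mathbb R$, $\mathbb E[e^{\lambda\kappa^i_t}\mid \mathcal H_t]\le e^{\lambda^2/2}$ a.s., where $\mathcal H_t$ is generated by $x_{1:t},y_{1:t},\hat B_{1:t},\kappa_{1:t-1}$. **Theorem.** Let $\mathrm{UC}$ be the event that, for some ball $B$, some objective $i$ and some $t\in\{1,\dots,T+1\}$ such that $B$ is active at the beginning of round $t$, with the values of $\hat\mu^i_B,u_B$ at the beginning of round $t$, $$\mu^i_{y_B}(x_B)\notin[\hat\mu^i_B-u_B-r(B),\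 \hat\mu^i_B+u_B+r(B)].$$ Then $\Pr(\mathrm{UC})\le\delta$, and almost surely on $\mathrm{UC}^c$ (hence with probability at least $1-\delta$), for every $p>0$, the Pareto regret $\mathrm{Reg}(T)=\sum_{t=1}^T\Delta_{y_t}(x_t)$ satisfies $$\mathrm{Reg}(T)\le\Big(28+112\,p\,\log\frac{2\sqrt2\,d_r\,T^{3/2}\,e}{\delta}\Big)\,T^{\frac{1+d_p}{2+d_p}}.$$ -/

import Mathlib

open MeasureTheory
open scoped ENNReal

namespace PCZ

/-! ### Pareto order, Pareto front, suboptimality gap -/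

/-- `a` is (Pareto) dominated by `b`. -/
def Dominated {ι α : Type*} [Preorder α] (a b : ι → α) : Prop :=
  (∀ i, a i ≤ b i) ∧ ∃ i, a i < b i

/-- Neither vector dominates the other. -/
def Incomparable {ι α : Type*} [Preorder α] (a b : ι → α) : Prop :=
  ¬ Dominated a b ∧ ¬ Dominated b a

/-- Pareto optimal arms given the context `x`; `μ x y i` is the expected reward of arm `y` in
objective `i` for context `x`. -/
def paretoFront {X Y : Type*} {d : ℕ} (μ : X → Y → Fin d → ℝ) (x : X) : Set Y :=
  {y | ∀ y', ¬ Dominated (μ x y) (μ x y')}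

/-- Pareto suboptimality gap: the least `ε ≥ 0` that has to be added to all entries of the reward
vector of `y` so that no arm of the Pareto front dominates it any more. See
`psg_eq_of_incomparable` for the formulation through incomparability. -/
noncomputable def psg {X Y : Type*} {d : ℕ} (μ : X → Y → Fin d → ℝ) (x : X) (y : Y) : ℝ :=
  sInf {ε : ℝ | 0 ≤ ε ∧ ∀ y' ∈ paretoFront μ x, ¬ Dominated (fun i => μ x y i + ε) (μ x y')}

/-- The gap is the infimum of the `ε ≥ 0` for which `μ x y + ε` is incomparable to every element
of the Pareto front, whenever there is such an `ε` at all. (On an infinite front there may be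
none; `psg` still has its intended value then.) -/
theorem psg_eq_of_incomparable {X Y : Type*} {d : ℕ} (μ : X → Y → Fin d → ℝ) (x : X) (y : Y)
    (h : {ε : ℝ | 0 ≤ ε ∧ ∀ y' ∈ paretoFront μ x,
      Incomparable (fun i => μ x y i + ε) (μ x y')}.Nonempty) :
    psg μ x y = sInf {ε : ℝ | 0 ≤ ε ∧ ∀ y' ∈ paretoFront μ x,
      Incomparable (fun i => μ x y i + ε) (μ x y')} := by
  obtain ⟨e, he0, he⟩ := h
  apply le_antisymm
  · exact csInf_le_csInf ⟨0, fun _ h => h.1⟩ ⟨e, he0, he⟩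
      (fun ε h => ⟨h.1, fun y' hy' => (h.2 y' hy').1⟩)
  · refine le_csInf ⟨e, he0, fun y' hy' => (he y' hy').1⟩ ?_
    rintro ε ⟨h0, hε⟩
    rcases le_total ε e with hle | hle
    · refine csInf_le ⟨0, fun _ h => h.1⟩ ⟨h0, fun y' hy' => ⟨hε y' hy', fun hd => ?_⟩⟩
      refine (he y' hy').2 ⟨fun i => (hd.1 i).trans (by simpa using hle), ?_⟩
      obtain ⟨i, hi⟩ := hd.2
      exact ⟨i, lt_of_lt_of_le hi (by simpa using hle)⟩
    · exact (csInf_le (s := {ε : ℝ | 0 ≤ ε ∧ ∀ y' ∈ paretoFront μ x,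
        Incomparable (fun i => μ x y i + ε) (μ x y')}) ⟨0, fun _ h => h.1⟩ ⟨he0, he⟩).trans hle

/-! ### Zooming dimension -/

/-- The `r`-packing number of `S`: the largest cardinality of a subset of `S` whose distinct
points have distance at least `r` (`⊤` if these cardinalities are unbounded). -/
noncomputable def packingNumber {Z : Type*} [PseudoMetricSpace Z] (r : ℝ) (S : Set Z) : ℕ∞ :=
  ⨆ (C : Set Z) (_ : C ⊆ S ∧ C.Pairwise fun z z' => r ≤ dist z z'), C.encard

/-- The Pareto `r`-zooming number: `r`-packing number of the pairs with gap at most `12 r`. -/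
noncomputable def zoomingNumber {X Y : Type*} [PseudoMetricSpace (X × Y)] {d : ℕ}
    (μ : X → Y → Fin d → ℝ) (r : ℝ) : ℕ∞ :=
  packingNumber r {z : X × Y | psg μ z.1 z.2 ≤ 12 * r}

/-- The Pareto zooming dimension for the constant `c`. The infimum is taken in `[0, ∞]`, so that it
is `∞` if no exponent is admissible. -/
noncomputable def zoomingDim {X Y : Type*} [PseudoMetricSpace (X × Y)] {d : ℕ}
    (μ : X → Y → Fin d → ℝ) (c : ℝ) : ℝ≥0∞ :=
  ⨅ (a : ℝ) (_ : 0 < a ∧ ∀ r : ℝ, 0 < r → r < 1 →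
      (zoomingNumber μ r : ℝ≥0∞) ≤ ENNReal.ofReal (c * r ^ (-a))),
    ENNReal.ofReal a

/-- The exponent `(1 + a) / (2 + a)`, with its limit `1` at `a = ∞`. -/
noncomputable def regretExponent (a : ℝ≥0∞) : ℝ :=
  if a = ⊤ then 1 else (1 + a.toReal) / (2 + a.toReal)

/-! ### The algorithm -/

/-- State of the algorithm at the beginning of a round: the active balls are numbered
`0, …, num - 1` in the order of their creation; values at larger numbers are irrelevant. -/
structure State (X Y : Type*) (d : ℕ) where
  /-- number of active balls -/
  num : ℕ
  /-- centers -/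
  center : ℕ → X × Y
  /-- radii -/
  radius : ℕ → ℝ
  /-- how often the ball has been chosen -/
  count : ℕ → ℕ
  /-- sample mean rewards -/
  mean : ℕ → Fin d → ℝ

/-- The constant `A = 1 + 2 log (2 √2 d T ^ (3/2) / δ)`. -/
noncomputable def confA (d T : ℕ) (δ : ℝ) : ℝ :=
  1 + 2 * Real.log (2 * Real.sqrt 2 * d * (T : ℝ) ^ (3 / 2 : ℝ) / δ)

/-- One ball of radius `1` with center `z₀`. -/
def init {X Y : Type*} (d : ℕ) (z₀ : X × Y) : State X Y d where
  num := 1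
  center := fun _ => z₀
  radius := fun _ => 1
  count := fun _ => 0
  mean := fun _ _ => 0

namespace State

variable {X Y : Type*} {d : ℕ}

/-- Sample uncertainty `√(2 A / N)`, infinite for a ball without samples. -/
noncomputable def unc (A : ℝ) (S : State X Y d) (k : ℕ) : EReal :=
  if S.count k = 0 then ⊤ else ((Real.sqrt (2 * A / S.count k) : ℝ) : EReal)

/-- The (closed) ball number `k`. -/
def ball [PseudoMetricSpace (X × Y)] (S : State X Y d) (k : ℕ) : Set (X × Y) :=
  Metric.closedBall (S.center k) (S.radius k)

/-- Domain of ball `k`: the ball without the active balls of strictly smaller radius. -/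
def dom [PseudoMetricSpace (X × Y)] (S : State X Y d) (k : ℕ) : Set (X × Y) :=
  S.ball k \ ⋃ (j : ℕ) (_ : j < S.num ∧ S.radius j < S.radius k), S.ball j

/-- Pre-index. -/
noncomputable def preIndex (A : ℝ) (S : State X Y d) (k : ℕ) (i : Fin d) : EReal :=
  (S.mean k i : EReal) + S.unc A k + (S.radius k : EReal)

/-- Index. -/
noncomputable def index [PseudoMetricSpace (X × Y)] (A : ℝ) (S : State X Y d) (k : ℕ)
    (i : Fin d) : EReal :=
  (S.radius k : EReal) +
    ⨅ j : Fin S.num, (S.preIndex A j i + ((dist (S.center j) (S.center k) : ℝ) : EReal))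

/-- Relevant balls for the context `x`. -/
def relevant [PseudoMetricSpace (X × Y)] (S : State X Y d) (x : X) : Set ℕ :=
  {k | k < S.num ∧ ∃ y : Y, (x, y) ∈ S.dom k}

/-- Relevant balls whose index is not dominated by the index of any relevant ball. -/
def paretoBalls [PseudoMetricSpace (X × Y)] (A : ℝ) (S : State X Y d) (x : X) : Set ℕ :=
  {k | k ∈ S.relevant x ∧ ∀ j ∈ S.relevant x, ¬ Dominated (S.index A k) (S.index A j)}

/-- For the context `x`, the algorithm may select the arm `y` and then the ball `k`: the arm is one
of `{y | (x, y) ∈ ⋃ k ∈ paretoBalls, dom k}`, and the ball is one of those in `paretoBalls` whose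
domain contains `(x, y)`. -/
def Admissible [PseudoMetricSpace (X × Y)] (A : ℝ) (S : State X Y d) (x : X) (y : Y)
    (k : ℕ) : Prop :=
  k ∈ S.paretoBalls A x ∧ (x, y) ∈ S.dom k

open Classical in
/-- End of a round in which the context was `x`, the arm `y` and the ball `k` were selected and the
reward vector `rew` was observed: a new ball is created if the uncertainty of ball `k` is at most
its radius, then the statistics of ball `k` are updated. -/
noncomputable def step (A : ℝ) (S : State X Y d) (x : X) (y : Y) (k : ℕ)
    (rew : Fin d → ℝ) : State X Y d :=
  let S' : State X Y d :=
    if S.unc A k ≤ (S.radius k : EReal) then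
      { num := S.num + 1
        center := Function.update S.center S.num (x, y)
        radius := Function.update S.radius S.num (S.radius k / 2)
        count := Function.update S.count S.num 0
        mean := Function.update S.mean S.num (fun _ => 0) }
    else S
  { S' with
    count := Function.update S'.count k (S'.count k + 1)
    mean := Function.update S'.mean k
      (fun i => (S'.mean k i * S'.count k + rew i) / (S'.count k + 1)) }

/-- Some confidence interval of an active ball misses the expected reward at its center. -/
def Unconfident (A : ℝ) (μ : X → Y → Fin d → ℝ) (S : State X Y d) : Prop :=
  ∃ k < S.num, ∃ i : Fin d,
    ¬ ((S.mean k i : EReal) - S.unc A k - (S.radius k : EReal) ≤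
          (μ (S.center k).1 (S.center k).2 i : EReal) ∧
        (μ (S.center k).1 (S.center k).2 i : EReal) ≤
          (S.mean k i : EReal) + S.unc A k + (S.radius k : EReal))

end State

/-- State after `t` rounds, for initial center `z₀`, contexts `x`, arms `y`, chosen balls `b` and
noise vectors `κ`; rounds are numbered `0, 1, …`. -/
noncomputable def run {X Y : Type*} {d : ℕ} (A : ℝ) (μ : X → Y → Fin d → ℝ) (z₀ : X × Y)
    (x : ℕ → X) (y : ℕ → Y) (b : ℕ → ℕ) (κ : ℕ → Fin d → ℝ) : ℕ → State X Y d
  | 0 => init d z₀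
  | t + 1 => (run A μ z₀ x y b κ t).step A (x t) (y t) (b t)
      (fun i => μ (x t) (y t) i + κ t i)

/-- Pareto regret of `T` rounds. -/
noncomputable def regret {X Y : Type*} {d : ℕ} (μ : X → Y → Fin d → ℝ) (x : ℕ → X) (y : ℕ → Y)
    (T : ℕ) : ℝ :=
  ∑ t ∈ Finset.range T, psg μ (x t) (y t)

/-! ### Noise -/

/-- What is known just before the reward of round `t`: the contexts, arms and ball choices up to
round `t` and the noise vectors of the earlier rounds. -/
@[reducible] def history {Ω X Y : Type*} [MeasurableSpace X] [MeasurableSpace Y] {d : ℕ}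
    (x : ℕ → Ω → X) (y : ℕ → Ω → Y) (b : ℕ → Ω → ℕ) (κ : ℕ → Ω → Fin d → ℝ) (t : ℕ) :
    MeasurableSpace Ω :=
  (⨆ (s : ℕ) (_ : s ≤ t), (MeasurableSpace.comap (x s) inferInstance ⊔
      MeasurableSpace.comap (y s) inferInstance ⊔ MeasurableSpace.comap (b s) inferInstance)) ⊔
    ⨆ (s : ℕ) (_ : s < t), MeasurableSpace.comap (κ s) inferInstance

/-- `Z` is conditionally `1`-sub-Gaussian given `m`. -/
def CondSubGaussian {Ω : Type*} (m : MeasurableSpace Ω) {m₀ : MeasurableSpace Ω} (P : Measure Ω)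
    (Z : Ω → ℝ) : Prop :=
  ∀ l : ℝ, Integrable (fun ω => Real.exp (l * Z ω)) P ∧
    P[fun ω => Real.exp (l * Z ω) | m] ≤ᵐ[P] fun _ => Real.exp (l ^ 2 / 2)

end PCZ

namespace PCZ

/-! ### Concentration of the noise along predictably chosen rounds -/

/-! Concentration. The ball selected in a round is fixed before the reward noise is seen, so
multiplying the factors `exp (l κ - l² / 2)` over the rounds in which a given ball is selected
yields a process of expectation at most `1` (`lintegral_expProcess_le`). The sample size is random,
but for each fixed value `n` one deterministic `l` is optimal, and Markov's inequality gives a tail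
`exp (-A)` (`measure_noise_sum_ge_le`). Samples of a ball come from points within its radius of the
center, so a failing confidence interval forces such a large noise sum
(`exists_noise_of_unconfident`). A union bound over round, ball number, sample size, objective and
sign costs `(T + 1)³ · 2 d`, which `A` absorbs.

Regret. While no interval fails, the index of a ball is optimistic at all its points (`le_index`). A
nondominated index that exceeds the played reward vector by at most `ε` therefore forces a gap at
most `ε` (`psg_le_of_admissible`). Such an upper bound comes from a nearby ball whose uncertainty
has dropped below its radius: the selected ball itself, or the ball that created it.

Each round is charged to a ball whose radius, times `14`, bounds the gap (`psg_le_charged`). A ball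
of radius `r` receives at most `2 A / r² + 2` charges (`card_charged_le`). Created balls of radius
`r` have `r`-separated centers of gap at most `12 r`, so the zooming number bounds how many there
are (`card_radius_le`). Radii are powers of `1 / 2`; summing over them, with a cut at `T ^ (-1 / (2
+ D))` where `D` is the zooming dimension, gives the rate (`sum_le_of_card_level_le`). -/

theorem lintegral_mul_le_of_condExp_le {Ω : Type*} {m m₀ : MeasurableSpace Ω} (hm : m ≤ m₀)
    (P : Measure Ω) [IsFiniteMeasure P] {f : Ω → ℝ} (hf : Integrable f P) (hf0 : 0 ≤ f) {c : ℝ}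
    (hc : P[f | m] ≤ᵐ[P] fun _ => c) {M : Ω → ℝ≥0∞} (hM : Measurable[m] M) :
    ∫⁻ ω, M ω * ENNReal.ofReal (f ω) ∂P ≤ ENNReal.ofReal c * ∫⁻ ω, M ω ∂P := by
  have hfm : AEMeasurable (fun ω => ENNReal.ofReal (f ω)) P := hf.1.aemeasurable.ennreal_ofReal
  -- Comparing measures on `m` avoids pulling `M` out of a conditional expectation, which would
  -- require integrability of the product.
  have key : (P.withDensity fun ω => ENNReal.ofReal (f ω)).trim hm ≤
      ENNReal.ofReal c • P.trim hm := by
    refine Measure.le_iff.2 fun s hs => ?_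
    rw [trim_measurableSet_eq hm hs, Measure.smul_apply, trim_measurableSet_eq hm hs,
      withDensity_apply _ (hm s hs), smul_eq_mul,
      ← ofReal_integral_eq_lintegral_ofReal hf.integrableOn (ae_of_all _ hf0),
      ← setIntegral_condExp hm hf hs]
    have h1 : ∫ ω in s, (P[f | m]) ω ∂P ≤ ∫ _ in s, c ∂P :=
      setIntegral_mono_ae integrable_condExp.integrableOn (integrableOn_const (by simp)) hc
    refine (ENNReal.ofReal_le_ofReal h1).trans ?_
    rw [setIntegral_const, smul_eq_mul, mul_comm, Measure.real,
      ENNReal.ofReal_mul' ENNReal.toReal_nonneg, ENNReal.ofReal_toReal (by simp)]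
  calc ∫⁻ ω, M ω * ENNReal.ofReal (f ω) ∂P
      = ∫⁻ ω, M ω ∂(P.withDensity fun ω => ENNReal.ofReal (f ω)) := by
        rw [lintegral_withDensity_eq_lintegral_mul₀ hfm (hM.mono hm le_rfl).aemeasurable]
        simp only [Pi.mul_apply, mul_comm]
    _ = ∫⁻ ω, M ω ∂(P.withDensity fun ω => ENNReal.ofReal (f ω)).trim hm :=
        (lintegral_trim hm hM).symm
    _ ≤ ∫⁻ ω, M ω ∂(ENNReal.ofReal c • P.trim hm) := lintegral_mono' key le_rfl
    _ = ENNReal.ofReal c * ∫⁻ ω, M ω ∂P := by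
        rw [lintegral_smul_measure, lintegral_trim hm hM, smul_eq_mul]

section Noise

variable {Ω X Y : Type*} [MeasurableSpace X] [MeasurableSpace Y] {d : ℕ}
  {x : ℕ → Ω → X} {y : ℕ → Ω → Y} {b : ℕ → Ω → ℕ} {κ : ℕ → Ω → Fin d → ℝ}

theorem history_le [MeasurableSpace Ω] (hx : ∀ t, Measurable (x t)) (hy : ∀ t, Measurable (y t))
    (hb : ∀ t, Measurable (b t)) (hκ : ∀ t, Measurable (κ t)) (t : ℕ) :
    history x y b κ t ≤ (inferInstance : MeasurableSpace Ω) :=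
  sup_le (iSup₂_le fun s _ => sup_le (sup_le (hx s).comap_le (hy s).comap_le) (hb s).comap_le)
    (iSup₂_le fun s _ => (hκ s).comap_le)

theorem measurable_choice_history {s t : ℕ} (h : s ≤ t) : Measurable[history x y b κ t] (b s) :=
  Measurable.of_comap_le <| le_sup_of_le_left <|
    le_iSup₂_of_le (f := fun (s : ℕ) (_ : s ≤ t) => (MeasurableSpace.comap (x s) inferInstance ⊔
      MeasurableSpace.comap (y s) inferInstance ⊔ MeasurableSpace.comap (b s) inferInstance))
      s h le_sup_right

theorem measurable_noise_history {s t : ℕ} (h : s < t) : Measurable[history x y b κ t] (κ s) :=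
  Measurable.of_comap_le <| le_sup_of_le_right <|
    le_iSup₂_of_le (f := fun (s : ℕ) (_ : s < t) => MeasurableSpace.comap (κ s) inferInstance)
      s h le_rfl

/-- Exponential process of the noise in objective `i`, over the rounds in which ball `k` is
selected. -/
noncomputable def expProcess (b : ℕ → Ω → ℕ) (κ : ℕ → Ω → Fin d → ℝ) (i : Fin d) (l : ℝ)
    (k t : ℕ) (ω : Ω) : ℝ≥0∞ :=
  ∏ s ∈ Finset.range t,
    if b s ω = k then ENNReal.ofReal (Real.exp (l * κ s ω i - l ^ 2 / 2)) else 1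

theorem expProcess_eq (i : Fin d) (l : ℝ) (k t : ℕ) (ω : Ω) :
    expProcess b κ i l k t ω = ENNReal.ofReal (Real.exp
      (l * ∑ s ∈ Finset.range t with b s ω = k, κ s ω i -
        ((Finset.range t).filter fun s => b s ω = k).card * (l ^ 2 / 2))) := by
  rw [expProcess, ← Finset.prod_filter,
    ← ENNReal.ofReal_prod_of_nonneg fun _ _ => (Real.exp_pos _).le, ← Real.exp_sum,
    Finset.sum_sub_distrib, Finset.mul_sum]
  simp

theorem measurable_expProcess (i : Fin d) (l : ℝ) (k t : ℕ) :
    Measurable[history x y b κ t] (expProcess b κ i l k t) := by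
  unfold expProcess
  refine Finset.measurable_fun_prod _ fun s hs => ?_
  have hs := Finset.mem_range.1 hs
  refine Measurable.ite (measurable_choice_history hs.le (measurableSet_singleton k)) ?_
    measurable_const
  have := (measurable_pi_apply i).comp (measurable_noise_history (x := x) (y := y) (b := b)
    (κ := κ) hs)
  exact (((this.const_mul l).sub_const _).exp).ennreal_ofReal

/-- Supermartingale step: the event that ball `k` is selected in round `t` belongs to the history
before the noise. On it the new factor has conditional mean at most `1`; off it the factor equals
`1`. -/
theorem lintegral_expProcess_le [MeasurableSpace Ω] (P : Measure Ω) [IsProbabilityMeasure P]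
    (hx : ∀ t, Measurable (x t)) (hy : ∀ t, Measurable (y t))
    (hb : ∀ t, Measurable (b t)) (hκ : ∀ t, Measurable (κ t)) (i : Fin d) {T : ℕ}
    (hnoise : ∀ t < T, CondSubGaussian (history x y b κ t) P (fun ω => κ t ω i))
    (l : ℝ) (k : ℕ) {t : ℕ} (ht : t ≤ T) : ∫⁻ ω, expProcess b κ i l k t ω ∂P ≤ 1 := by
  induction t with
  | zero => simp [expProcess]
  | succ t ih =>
    refine le_trans ?_ (ih (by omega))
    have hm := history_le hx hy hb hκ t
    obtain ⟨hint, hce⟩ := hnoise t (by omega) l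
    have hM := measurable_expProcess (x := x) (y := y) (b := b) (κ := κ) i l k t
    have hE : MeasurableSet[history x y b κ t] {ω | b t ω = k} :=
      measurable_choice_history le_rfl (measurableSet_singleton k)
    set M := expProcess b κ i l k t with hMdef
    have h1 := lintegral_mul_le_of_condExp_le hm P hint (fun ω => (Real.exp_pos _).le) hce
      (M := fun ω => {ω | b t ω = k}.indicator M ω) (hM.indicator hE)
    have hsplit : ∀ ω, expProcess b κ i l k (t + 1) ω =
        {ω | b t ω = k}.indicator M ω * ENNReal.ofReal (Real.exp (l * κ t ω i)) *
          ENNReal.ofReal (Real.exp (-(l ^ 2 / 2))) + {ω | b t ω = k}ᶜ.indicator M ω := by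
      intro ω
      rw [expProcess, Finset.prod_range_succ]
      by_cases h : b t ω = k
      · simp [h, hMdef, expProcess, sub_eq_add_neg, Real.exp_add, mul_assoc,
          ENNReal.ofReal_mul (Real.exp_pos _).le]
      · simp [h, hMdef, expProcess]
    have hE' : Measurable ({ω | b t ω = k}ᶜ.indicator M) := (hM.indicator hE.compl).mono hm le_rfl
    simp_rw [hsplit]
    rw [lintegral_add_right _ hE', lintegral_mul_const' _ _ ENNReal.ofReal_ne_top]
    calc _ ≤ ENNReal.ofReal (Real.exp (l ^ 2 / 2)) * (∫⁻ ω, {ω | b t ω = k}.indicator M ω ∂P) *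
            ENNReal.ofReal (Real.exp (-(l ^ 2 / 2))) +
            ∫⁻ ω, {ω | b t ω = k}ᶜ.indicator M ω ∂P := by gcongr
      _ = ∫⁻ ω, {ω | b t ω = k}.indicator M ω ∂P +
            ∫⁻ ω, {ω | b t ω = k}ᶜ.indicator M ω ∂P := by
          rw [mul_right_comm, ← ENNReal.ofReal_mul (Real.exp_pos _).le, ← Real.exp_add]
          simp
      _ = ∫⁻ ω, M ω ∂P := by
          rw [lintegral_indicator (hm _ hE), lintegral_indicator (hm _ hE.compl),
            lintegral_add_compl _ (hm _ hE)]

/-- Fixing the sample size `n` makes the exponent `l` deterministic, so Markov's inequality applies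
to `expProcess`. -/
theorem measure_noise_sum_ge_le [MeasurableSpace Ω] (P : Measure Ω) [IsProbabilityMeasure P]
    (hx : ∀ t, Measurable (x t)) (hy : ∀ t, Measurable (y t))
    (hb : ∀ t, Measurable (b t)) (hκ : ∀ t, Measurable (κ t)) (i : Fin d) {T : ℕ}
    (hnoise : ∀ t < T, CondSubGaussian (history x y b κ t) P (fun ω => κ t ω i))
    {A : ℝ} (hA : 0 ≤ A) {σ : ℝ} (hσ : σ ^ 2 = 1) (k n : ℕ) {t : ℕ} (ht : t ≤ T) :
    P {ω | n ≠ 0 ∧ ((Finset.range t).filter fun s => b s ω = k).card = n ∧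
      Real.sqrt (2 * A * n) ≤ σ * ∑ s ∈ Finset.range t with b s ω = k, κ s ω i} ≤
      ENNReal.ofReal (Real.exp (-A)) := by
  -- This `l` maximizes `|l| √(2 A n) - n l² / 2`; the maximum is `2 A - A = A`.
  set l := σ * Real.sqrt (2 * A / n) with hl
  have hmeas : AEMeasurable (expProcess b κ i l k t) P :=
    ((measurable_expProcess (x := x) (y := y) i l k t).mono (history_le hx hy hb hκ t)
      le_rfl).aemeasurable
  have hmarkov := mul_meas_ge_le_lintegral₀ hmeas (ENNReal.ofReal (Real.exp A))
  have h1 := hmarkov.trans (lintegral_expProcess_le P hx hy hb hκ i hnoise l k ht)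
  have h2 : P {ω | ENNReal.ofReal (Real.exp A) ≤ expProcess b κ i l k t ω} ≤
      ENNReal.ofReal (Real.exp (-A)) := by
    rw [Real.exp_neg, ENNReal.ofReal_inv_of_pos (Real.exp_pos A), ENNReal.le_inv_iff_mul_le,
      mul_comm]
    exact h1
  refine (measure_mono ?_).trans h2
  rintro ω ⟨hn, hcard, hsum⟩
  rw [Set.mem_ofPred_eq, expProcess_eq, hcard]
  refine ENNReal.ofReal_le_ofReal (Real.exp_le_exp.2 ?_)
  have hn' : (0 : ℝ) < n := by exact_mod_cast Nat.pos_of_ne_zero hn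
  set s := Real.sqrt (2 * A / n) with hs
  have hs2 : s ^ 2 = 2 * A / n := Real.sq_sqrt (by positivity)
  have hs0 : 0 ≤ s := Real.sqrt_nonneg _
  have hprod : s * Real.sqrt (2 * A * n) = 2 * A := by
    rw [hs, ← Real.sqrt_mul (by positivity)]
    rw [show 2 * A / n * (2 * A * n) = (2 * A) ^ 2 by field_simp]
    exact Real.sqrt_sq (by positivity)
  have h3 := mul_le_mul_of_nonneg_left hsum hs0
  have h4 : (n : ℝ) * (l ^ 2 / 2) = A := by
    rw [hl, mul_pow, hσ, hs2]; field_simp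
  rw [h4, hl]
  linarith

end Noise

end PCZ

namespace PCZ

/-! ### The suboptimality gap -/

section Gap

variable {X Y : Type*} {d : ℕ} {μ : X → Y → Fin d → ℝ}

theorem psg_le {x : X} {y : Y} {ε : ℝ} (h0 : 0 ≤ ε)
    (h : ∀ y' ∈ paretoFront μ x, ¬ Dominated (fun i => μ x y i + ε) (μ x y')) : psg μ x y ≤ ε :=
  csInf_le ⟨0, fun _ h => h.1⟩ ⟨h0, h⟩

theorem psg_le_one [PseudoMetricSpace (X × Y)] (hdiam : ∀ z z' : X × Y, dist z z' ≤ 1)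
    (hLip : ∀ (i : Fin d) (z z' : X × Y), |μ z.1 z.2 i - μ z'.1 z'.2 i| ≤ dist z z')
    (x : X) (y : Y) : psg μ x y ≤ 1 := by
  refine psg_le zero_le_one fun y' _ h => ?_
  obtain ⟨i, hi⟩ := h.2
  have := (abs_le.1 ((hLip i (x, y) (x, y')).trans (hdiam _ _))).1
  dsimp at this
  linarith

end Gap

/-! ### Confident states -/

namespace State

variable {X Y : Type*} {d : ℕ}

theorem unc_le_iff {A : ℝ} {S : State X Y d} {k : ℕ} {r : ℝ} :
    S.unc A k ≤ (r : EReal) ↔ S.count k ≠ 0 ∧ Real.sqrt (2 * A / S.count k) ≤ r := by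
  unfold unc
  split_ifs with h
  · simp [h]
  · simp [h]

theorem unc_le_of_count_le {A : ℝ} (hA : 0 ≤ A) {S S' : State X Y d} {k : ℕ} {r : ℝ}
    (h : S.unc A k ≤ (r : EReal)) (hc : S.count k ≤ S'.count k) : S'.unc A k ≤ (r : EReal) := by
  rw [unc_le_iff] at h ⊢
  obtain ⟨h0, h1⟩ := h
  refine ⟨by omega, le_trans (Real.sqrt_le_sqrt ?_) h1⟩
  have : (0 : ℝ) < S.count k := by exact_mod_cast Nat.pos_of_ne_zero h0
  gcongr

variable {A : ℝ} {μ : X → Y → Fin d → ℝ} {S : State X Y d}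

theorem mean_le_preIndex (hconf : ¬ S.Unconfident A μ) {k : ℕ} (hk : k < S.num) (i : Fin d) :
    (μ (S.center k).1 (S.center k).2 i : EReal) ≤ S.preIndex A k i := by
  by_contra h
  exact hconf ⟨k, hk, i, fun h' => h h'.2⟩

theorem preIndex_le (hconf : ¬ S.Unconfident A μ) {k : ℕ} (hk : k < S.num) {r : ℝ}
    (hr : S.unc A k ≤ (r : EReal)) (i : Fin d) :
    S.preIndex A k i ≤ ((μ (S.center k).1 (S.center k).2 i + 2 * r + 2 * S.radius k : ℝ) :
      EReal) := by
  have h : (S.mean k i : EReal) - S.unc A k - (S.radius k : EReal) ≤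
      (μ (S.center k).1 (S.center k).2 i : EReal) := by
    by_contra h
    exact hconf ⟨k, hk, i, fun h' => h h'.1⟩
  obtain ⟨h0, hu⟩ := unc_le_iff.1 hr
  rw [preIndex]
  rw [unc, if_neg h0] at h ⊢
  norm_cast at h ⊢
  linarith

variable [PseudoMetricSpace (X × Y)]

/-- Optimism: every pre-index dominates the mean at its own center, the distance term carries this
to the center of `k`, and the extra radius carries it on to `z`. -/
theorem le_index (hLip : ∀ (i : Fin d) (z z' : X × Y), |μ z.1 z.2 i - μ z'.1 z'.2 i| ≤ dist z z')
    (hconf : ¬ S.Unconfident A μ) {k : ℕ} {z : X × Y} (hz : z ∈ S.ball k)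
    (i : Fin d) : (μ z.1 z.2 i : EReal) ≤ S.index A k i := by
  have h1 : ∀ j : Fin S.num, ((μ (S.center k).1 (S.center k).2 i : ℝ) : EReal) ≤
      S.preIndex A j i + ((dist (S.center j) (S.center k) : ℝ) : EReal) := by
    intro j
    refine le_trans ?_ (add_le_add_left (mean_le_preIndex hconf j.2 i) _)
    have := (abs_le.1 (hLip i (S.center j) (S.center k))).1
    norm_cast
    linarith
  refine le_trans ?_ (add_le_add_right (le_iInf h1) _)
  have h2 := (abs_le.1 (hLip i z (S.center k))).2
  have h3 : dist z (S.center k) ≤ S.radius k := hz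
  norm_cast
  linarith

/-- A ball with uncertainty at most its radius overestimates by at most `4` radii: twice the
uncertainty plus twice the radius. The minimum in the index lets any such ball `j` serve as a bound.
-/
theorem index_le (hconf : ¬ S.Unconfident A μ) {j : ℕ} (hj : j < S.num)
    (hu : S.unc A j ≤ (S.radius j : EReal)) (k : ℕ) (i : Fin d) :
    S.index A k i ≤ ((S.radius k + (μ (S.center j).1 (S.center j).2 i + 4 * S.radius j +
      dist (S.center j) (S.center k)) : ℝ) : EReal) := by
  rw [index, EReal.coe_add]
  refine add_le_add_right ?_ _
  refine (iInf_le _ (⟨j, hj⟩ : Fin S.num)).trans ?_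
  rw [EReal.coe_add]
  refine add_le_add_left ((preIndex_le hconf hj hu i).trans ?_) _
  norm_cast
  linarith

/-- Every point of an active ball is in the domain of some active ball. -/
theorem exists_mem_dom {k : ℕ} (hk : k < S.num) {z : X × Y} (hz : z ∈ S.ball k) :
    ∃ j < S.num, z ∈ S.dom j := by
  classical
  obtain ⟨j, hj, hmin⟩ := Finset.exists_min_image
    ((Finset.range S.num).filter fun j => z ∈ S.ball j) S.radius ⟨k, by simp [hk, hz]⟩
  simp only [Finset.mem_filter, Finset.mem_range] at hj hmin
  refine ⟨j, hj.1, hj.2, ?_⟩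
  simp only [Set.mem_iUnion, not_exists, and_imp]
  intro l hl hlt hzl
  exact absurd (hmin l ⟨hl, hzl⟩) (not_le.2 hlt)

/-- If `y'` still dominated `y` after adding `ε`, a relevant ball with `(x, y')` in its domain
would, by optimism, have an index dominating that of the selected ball. -/
theorem psg_le_of_admissible
    (hLip : ∀ (i : Fin d) (z z' : X × Y), |μ z.1 z.2 i - μ z'.1 z'.2 i| ≤ dist z z')
    (hconf : ¬ S.Unconfident A μ) (hcover : ∀ z : X × Y, ∃ k < S.num, z ∈ S.ball k)
    {x : X} {y : Y} {k : ℕ} (hadm : S.Admissible A x y k) {ε : ℝ} (hε : 0 ≤ ε)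
    (hidx : ∀ i, S.index A k i ≤ ((μ x y i + ε : ℝ) : EReal)) : psg μ x y ≤ ε := by
  refine psg_le hε fun y' _ hdom => ?_
  obtain ⟨l, hl, hlz⟩ := hcover (x, y')
  obtain ⟨j, hj, hjz⟩ := exists_mem_dom hl hlz
  refine hadm.1.2 j ⟨hj, y', hjz⟩ ⟨fun i => ?_, ?_⟩
  · exact (hidx i).trans ((EReal.coe_le_coe_iff.2 (hdom.1 i)).trans
      (le_index hLip hconf (z := (x, y')) hjz.1 i))
  · obtain ⟨i, hi⟩ := hdom.2
    exact ⟨i, (hidx i).trans_lt ((EReal.coe_lt_coe_iff.2 hi).trans_le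
      (le_index hLip hconf (z := (x, y')) hjz.1 i))⟩

/-- The gap is small if the uncertainty of the selected ball is small. -/
theorem psg_le_of_unc_le
    (hLip : ∀ (i : Fin d) (z z' : X × Y), |μ z.1 z.2 i - μ z'.1 z'.2 i| ≤ dist z z')
    (hconf : ¬ S.Unconfident A μ) (hcover : ∀ z : X × Y, ∃ k < S.num, z ∈ S.ball k)
    {x : X} {y : Y} {k : ℕ} (hadm : S.Admissible A x y k)
    (hu : S.unc A k ≤ (S.radius k : EReal)) : psg μ x y ≤ 6 * S.radius k := by
  have hz : dist (x, y) (S.center k) ≤ S.radius k := hadm.2.1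
  have h0 : 0 ≤ S.radius k := dist_nonneg.trans hz
  refine psg_le_of_admissible hLip hconf hcover hadm (by positivity) fun i => ?_
  -- In radii: `1 + 4` from the index, `1` from the center to the played point.
  refine (index_le hconf hadm.1.1.1 hu k i).trans (EReal.coe_le_coe_iff.2 ?_)
  have := (abs_le.1 (hLip i (x, y) (S.center k))).1
  dsimp at this
  rw [dist_self]
  linarith

/-- The gap is small if the selected ball has a nearby ball, twice as large, of small uncertainty. -/
theorem psg_le_of_parent
    (hLip : ∀ (i : Fin d) (z z' : X × Y), |μ z.1 z.2 i - μ z'.1 z'.2 i| ≤ dist z z')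
    (hconf : ¬ S.Unconfident A μ) (hcover : ∀ z : X × Y, ∃ k < S.num, z ∈ S.ball k)
    {x : X} {y : Y} {k : ℕ} (hadm : S.Admissible A x y k) {j : ℕ} (hj : j < S.num)
    (hr : S.radius j = 2 * S.radius k) (hu : S.unc A j ≤ (S.radius j : EReal))
    (hjk : S.center k ∈ S.ball j) : psg μ x y ≤ 14 * S.radius k := by
  have hz : dist (x, y) (S.center k) ≤ S.radius k := hadm.2.1
  have h0 : 0 ≤ S.radius k := dist_nonneg.trans hz
  have hjk' : dist (S.center k) (S.center j) ≤ S.radius j := hjk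
  refine psg_le_of_admissible hLip hconf hcover hadm (by positivity) fun i => ?_
  -- In radii of `k`: `1` from the index, `4 · 2` from the overestimate at `j`, `2` for the distance
  -- term, `2` and `1` for moving the mean from the center of `j` to that of `k` and to `(x, y)`.
  refine (index_le hconf hj hu k i).trans (EReal.coe_le_coe_iff.2 ?_)
  have h1 := (abs_le.1 (hLip i (x, y) (S.center k))).1
  have h2 := (abs_le.1 (hLip i (S.center k) (S.center j))).1
  rw [dist_comm (S.center j)]
  dsimp at h1
  linarith

end State

end PCZ

namespace PCZ

/-! ### Trajectories of the algorithm -/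

/-- `S` is the sequence of states of the algorithm when, for `T` rounds, all selections are
admissible. -/
structure IsTrajectory {X Y : Type*} {d : ℕ} [PseudoMetricSpace (X × Y)] (A : ℝ) (z₀ : X × Y)
    (x : ℕ → X) (y : ℕ → Y) (b : ℕ → ℕ) (rew : ℕ → Fin d → ℝ) (S : ℕ → State X Y d) (T : ℕ) :
    Prop where
  zero : S 0 = init d z₀
  succ : ∀ t, S (t + 1) = (S t).step A (x t) (y t) (b t) (rew t)
  adm : ∀ t < T, (S t).Admissible A (x t) (y t) (b t)

/-! ### Effect of one round on the state -/

namespace State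

variable {X Y : Type*} {d : ℕ} (A : ℝ) (S : State X Y d) (x : X) (y : Y) (k : ℕ)
  (rew : Fin d → ℝ)

/-- Selecting ball `k` triggers the creation of a new ball. -/
def Spawns : Prop := S.unc A k ≤ (S.radius k : EReal)

variable {A S k}

theorem num_step_of_spawns (h : S.Spawns A k) : (S.step A x y k rew).num = S.num + 1 := by
  rw [Spawns] at h; simp [step, h]

theorem num_step_of_not_spawns (h : ¬ S.Spawns A k) : (S.step A x y k rew).num = S.num := by
  rw [Spawns] at h; simp [step, h]

theorem center_step_of_spawns (h : S.Spawns A k) :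
    (S.step A x y k rew).center S.num = (x, y) := by
  rw [Spawns] at h; simp [step, h]

theorem radius_step_of_spawns (h : S.Spawns A k) :
    (S.step A x y k rew).radius S.num = S.radius k / 2 := by
  rw [Spawns] at h; simp [step, h]

theorem num_le_num_step : S.num ≤ (S.step A x y k rew).num := by
  by_cases h : S.Spawns A k
  · rw [num_step_of_spawns _ _ _ h]; omega
  · rw [num_step_of_not_spawns _ _ _ h]

theorem num_step_le : (S.step A x y k rew).num ≤ S.num + 1 := by
  by_cases h : S.Spawns A k
  · rw [num_step_of_spawns _ _ _ h]
  · rw [num_step_of_not_spawns _ _ _ h]; omega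

theorem center_step {j : ℕ} (hj : j < S.num) :
    (S.step A x y k rew).center j = S.center j := by
  unfold step
  split_ifs <;> simp [Function.update_of_ne hj.ne]

theorem radius_step {j : ℕ} (hj : j < S.num) :
    (S.step A x y k rew).radius j = S.radius j := by
  unfold step
  split_ifs <;> simp [Function.update_of_ne hj.ne]

/-- The vanishing counter in the next free slot makes the identity hold for all `j`, whether or not
that slot is reset by a creation. -/
theorem count_step (hk : k < S.num) (h0 : S.count S.num = 0) (j : ℕ) :
    (S.step A x y k rew).count j = S.count j + if k = j then 1 else 0 := by
  unfold step
  by_cases hjk : k = j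
  · subst hjk
    rw [if_pos rfl]
    split_ifs <;> simp [hk.ne]
  · rw [if_neg hjk]
    have hjk' : j ≠ k := fun h => hjk h.symm
    split_ifs
    · by_cases hj : j = S.num
      · simp [hj, hk.ne', h0]
      · simp [hjk', hj]
    · simp [hjk']

theorem mean_mul_count_step (hk : k < S.num) (h0 : S.count S.num = 0) (j : ℕ) (i : Fin d) :
    (S.step A x y k rew).mean j i * (S.step A x y k rew).count j =
      S.mean j i * S.count j + if k = j then rew i else 0 := by
  unfold step
  by_cases hjk : k = j
  · subst hjk
    have h : (S.count k : ℝ) + 1 ≠ 0 := by positivity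
    rw [if_pos rfl]
    split_ifs <;> simp [hk.ne] <;> field_simp
  · rw [if_neg hjk]
    have hjk' : j ≠ k := fun h => hjk h.symm
    split_ifs
    · by_cases hj : j = S.num
      · simp [hj, hk.ne', h0]
      · simp [hjk', hj]
    · simp [hjk']

end State

/-! ### Invariants along a trajectory -/

namespace IsTrajectory

variable {X Y : Type*} {d : ℕ} [PseudoMetricSpace (X × Y)] {A : ℝ} {z₀ : X × Y}
  {x : ℕ → X} {y : ℕ → Y} {b : ℕ → ℕ} {rew : ℕ → Fin d → ℝ} {S : ℕ → State X Y d} {T : ℕ}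
  (h : IsTrajectory A z₀ x y b rew S T)

include h

theorem num_mono : Monotone fun t => (S t).num :=
  monotone_nat_of_le_succ fun t => by
    rw [h.succ]; exact State.num_le_num_step _ _ _

theorem num_pos (t : ℕ) : 0 < (S t).num := by
  have := h.num_mono (Nat.zero_le t)
  simp only [h.zero, init] at this
  omega

theorem num_le (t : ℕ) : (S t).num ≤ t + 1 := by
  induction t with
  | zero => simp [h.zero, init]
  | succ t ih =>
    rw [h.succ]
    exact (State.num_step_le _ _ _).trans (by omega)

theorem num_lt_of_spawns {s t : ℕ} (hs : (S s).Spawns A (b s)) (hst : s < t) :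
    (S s).num < (S t).num := by
  have := h.num_mono (Nat.succ_le_of_lt hst)
  simp only [h.succ, State.num_step_of_spawns _ _ _ hs] at this
  exact this

theorem center_eq {s t : ℕ} (hst : s ≤ t) {k : ℕ} (hk : k < (S s).num) :
    (S t).center k = (S s).center k := by
  induction t, hst using Nat.le_induction with
  | base => rfl
  | succ t hst ih => rw [h.succ, State.center_step _ _ _ (hk.trans_le (h.num_mono hst)), ih]

theorem radius_eq {s t : ℕ} (hst : s ≤ t) {k : ℕ} (hk : k < (S s).num) :
    (S t).radius k = (S s).radius k := by
  induction t, hst using Nat.le_induction with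
  | base => rfl
  | succ t hst ih => rw [h.succ, State.radius_step _ _ _ (hk.trans_le (h.num_mono hst)), ih]

theorem radius_zero (t : ℕ) : (S t).radius 0 = 1 := by
  rw [h.radius_eq (Nat.zero_le t) (h.num_pos 0), h.zero]; rfl

theorem exists_mem_ball (hdiam : ∀ z z' : X × Y, dist z z' ≤ 1) (t : ℕ) (z : X × Y) :
    ∃ k < (S t).num, z ∈ (S t).ball k :=
  ⟨0, h.num_pos t, by
    rw [State.ball, h.radius_zero]; exact hdiam _ _⟩

theorem lt_num {t : ℕ} (ht : t < T) : b t < (S t).num := (h.adm t ht).1.1.1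

theorem card_filter_num {t : ℕ} (ht : t ≤ T) :
    ((Finset.range t).filter fun s => b s = (S t).num).card = 0 := by
  rw [Finset.card_eq_zero, Finset.filter_eq_empty_iff]
  intro s hs hbs
  have hs := Finset.mem_range.1 hs
  have h1 := h.lt_num (t := s) (by omega)
  have h2 : (S s).num ≤ (S t).num := h.num_mono hs.le
  omega

theorem count_eq {t : ℕ} (ht : t ≤ T) (k : ℕ) :
    (S t).count k = ((Finset.range t).filter fun s => b s = k).card := by
  induction t generalizing k with
  | zero => simp [h.zero, init]
  | succ t ih =>
    have h0 : (S t).count (S t).num = 0 := by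
      rw [ih (by omega), h.card_filter_num (by omega)]
    rw [h.succ, State.count_step _ _ _ (h.lt_num ht) h0, ih (by omega), Finset.range_add_one,
      Finset.filter_insert]
    split_ifs <;> simp

theorem count_num {t : ℕ} (ht : t ≤ T) : (S t).count (S t).num = 0 := by
  rw [h.count_eq ht, h.card_filter_num ht]

theorem mean_mul_count_eq {t : ℕ} (ht : t ≤ T) (k : ℕ) (i : Fin d) :
    (S t).mean k i * (S t).count k = ∑ s ∈ Finset.range t with b s = k, rew s i := by
  induction t generalizing k with
  | zero => simp [h.zero, init]
  | succ t ih =>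
    rw [h.succ, State.mean_mul_count_step _ _ _ (h.lt_num ht) (h.count_num (by omega)),
      ih (by omega), Finset.sum_filter, Finset.sum_filter, Finset.sum_range_succ]

theorem count_mono {s t : ℕ} (hst : s ≤ t) (ht : t ≤ T) (k : ℕ) :
    (S s).count k ≤ (S t).count k := by
  rw [h.count_eq ht, h.count_eq (hst.trans ht)]
  exact Finset.card_le_card (Finset.filter_subset_filter _ (Finset.range_subset_range.2 hst))

theorem count_lt {s t : ℕ} (hst : s < t) (ht : t ≤ T) : (S s).count (b s) < (S t).count (b s) := by
  refine lt_of_lt_of_le ?_ (h.count_mono (Nat.succ_le_of_lt hst) ht _)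
  rw [h.succ, State.count_step _ _ _ (h.lt_num (by omega)) (h.count_num (by omega))]
  simp

/-- Every ball but the initial one was created in some round. -/
theorem exists_spawns {t k : ℕ} (hk : k < (S t).num) (hk0 : k ≠ 0) :
    ∃ s < t, (S s).Spawns A (b s) ∧ (S s).num = k := by
  induction t with
  | zero => simp [h.zero, init] at hk; omega
  | succ t ih =>
    by_cases hkt : k < (S t).num
    · obtain ⟨s, hs, h1⟩ := ih hkt
      exact ⟨s, by omega, h1⟩
    · refine ⟨t, by omega, ?_⟩
      rw [h.succ] at hk
      by_cases hsp : (S t).Spawns A (b t)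
      · rw [State.num_step_of_spawns _ _ _ hsp] at hk
        exact ⟨hsp, by omega⟩
      · rw [State.num_step_of_not_spawns _ _ _ hsp] at hk
        omega

theorem center_num {s t : ℕ} (hs : (S s).Spawns A (b s)) (hst : s < t) :
    (S t).center (S s).num = (x s, y s) := by
  rw [h.center_eq (Nat.succ_le_of_lt hst) (h.num_lt_of_spawns hs (Nat.lt_succ_self s)), h.succ,
    State.center_step_of_spawns _ _ _ hs]

theorem radius_num {s t : ℕ} (hs : (S s).Spawns A (b s)) (hst : s < t) :
    (S t).radius (S s).num = (S s).radius (b s) / 2 := by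
  rw [h.radius_eq (Nat.succ_le_of_lt hst) (h.num_lt_of_spawns hs (Nat.lt_succ_self s)), h.succ,
    State.radius_step_of_spawns _ _ _ hs]

/-- A ball has half the radius of its creator, whose number is smaller. The second clause says that
level `0` holds the initial ball only. -/
theorem exists_radius_eq {t : ℕ} (ht : t ≤ T) {k : ℕ} (hk : k < (S t).num) :
    ∃ l : ℕ, (S t).radius k = (1 / 2 : ℝ) ^ l ∧ (l = 0 → k = 0) := by
  induction k using Nat.strong_induction_on generalizing t with
  | _ k ih =>
    by_cases hk0 : k = 0
    · exact ⟨0, by rw [hk0, h.radius_zero]; simp, fun _ => hk0⟩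
    · obtain ⟨s, hst, hs, rfl⟩ := h.exists_spawns hk hk0
      obtain ⟨l, hl, -⟩ := ih _ (h.lt_num (hst.trans_le ht)) (hst.le.trans ht)
        (h.lt_num (hst.trans_le ht))
      exact ⟨l + 1, by rw [h.radius_num hs hst, hl]; ring, by simp⟩

end IsTrajectory
end PCZ

namespace PCZ

/-! ### Failing intervals and charging of rounds to balls -/

namespace IsTrajectory

variable {X Y : Type*} {d : ℕ} [PseudoMetricSpace (X × Y)] {A : ℝ} {z₀ : X × Y}
  {x : ℕ → X} {y : ℕ → Y} {b : ℕ → ℕ} {S : ℕ → State X Y d} {T : ℕ} {μ : X → Y → Fin d → ℝ}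

/-- A confidence interval can fail only if the noise summed over the rounds in which the ball was
selected is large. -/
theorem exists_noise_of_unconfident {κ : ℕ → Fin d → ℝ}
    (h : IsTrajectory A z₀ x y b (fun t i => μ (x t) (y t) i + κ t i) S T)
    (hLip : ∀ (i : Fin d) (z z' : X × Y), |μ z.1 z.2 i - μ z'.1 z'.2 i| ≤ dist z z')
    {t : ℕ} (ht : t ≤ T) (hun : (S t).Unconfident A μ) :
    ∃ k ≤ t, ∃ n ≤ t, ∃ i, ∃ σ ∈ ({1, -1} : Finset ℝ), n ≠ 0 ∧
      ((Finset.range t).filter fun s => b s = k).card = n ∧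
      Real.sqrt (2 * A * n) ≤ σ * ∑ s ∈ Finset.range t with b s = k, κ s i := by
  obtain ⟨k, hk, i, hki⟩ := hun
  have hkt : k ≤ t := Nat.lt_succ_iff.1 (hk.trans_le (h.num_le t))
  have hcard : ((Finset.range t).filter fun s => b s = k).card ≤ t :=
    (Finset.card_filter_le _ _).trans (by simp)
  refine ⟨k, hkt, _, hcard, i, ?_⟩
  by_contra hcon
  apply hki
  have hcount := h.count_eq ht k
  -- Without samples the interval is the whole extended line, so it cannot fail.
  by_cases h0 : (S t).count k = 0
  · simp [State.unc, h0]
  set n := ((Finset.range t).filter fun s => b s = k).card with hn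
  have hn0 : n ≠ 0 := hcount ▸ h0
  have hnpos : (0 : ℝ) < n := by exact_mod_cast Nat.pos_of_ne_zero hn0
  set N := ∑ s ∈ Finset.range t with b s = k, κ s i with hN
  have hN1 : N < Real.sqrt (2 * A * n) := by
    by_contra hle
    exact hcon ⟨1, by simp, hn0, rfl, by linarith⟩
  have hN2 : -N < Real.sqrt (2 * A * n) := by
    by_contra hle
    exact hcon ⟨-1, by simp, hn0, rfl, by linarith⟩
  have hsq : Real.sqrt (2 * A * n) = n * Real.sqrt (2 * A / n) := by
    rw [show 2 * A * (n : ℝ) = (n : ℝ) ^ 2 * (2 * A / n) by field_simp,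
      Real.sqrt_mul (by positivity), Real.sqrt_sq hnpos.le]
  have hmean := h.mean_mul_count_eq ht k i
  rw [hcount, Finset.sum_add_distrib, ← hN] at hmean
  set c := (S t).center k with hc
  set r := (S t).radius k with hr
  -- Sampled points lie in the ball, so the bias of the sample mean is at most the radius.
  have hdist : ∀ s ∈ (Finset.range t).filter fun s => b s = k,
      |μ (x s) (y s) i - μ c.1 c.2 i| ≤ r := by
    intro s hs
    simp only [Finset.mem_filter, Finset.mem_range] at hs
    obtain ⟨hst, rfl⟩ := hs
    have hsT := hst.trans_le ht
    rw [hc, hr, h.center_eq hst.le (h.lt_num hsT), h.radius_eq hst.le (h.lt_num hsT)]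
    exact (hLip i (x s, y s) _).trans (h.adm s hsT).2.1
  have hsum1 := Finset.sum_le_card_nsmul _ (fun s => μ (x s) (y s) i) (μ c.1 c.2 i + r)
    fun s hs => by linarith [(abs_le.1 (hdist s hs)).2]
  have hsum2 := Finset.card_nsmul_le_sum _ (fun s => μ (x s) (y s) i) (μ c.1 c.2 i - r)
    fun s hs => by linarith [(abs_le.1 (hdist s hs)).1]
  rw [← hn, nsmul_eq_mul] at hsum1 hsum2
  rw [State.unc, if_neg h0, hcount]
  rw [hsq] at hN1 hN2
  norm_cast
  constructor <;> refine le_of_mul_le_mul_left ?_ hnpos <;> linarith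

variable {rew : ℕ → Fin d → ℝ} (h : IsTrajectory A z₀ x y b rew S T)

open Classical in
/-- The ball that is charged for round `t`: the new ball if there is one, and the selected ball
otherwise. -/
noncomputable def charged (A : ℝ) (S : ℕ → State X Y d) (b : ℕ → ℕ) (t : ℕ) : ℕ :=
  if (S t).Spawns A (b t) then (S t).num else b t

include h

theorem charged_lt {t : ℕ} (ht : t < T) : charged A S b t < (S T).num := by
  unfold charged
  split_ifs with hs
  · exact h.num_lt_of_spawns hs ht
  · exact (h.lt_num ht).trans_le (h.num_mono ht.le)

/-- In a creating round the selected ball is its own witness, and its gap bound `6 r` is `12` times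
the new radius. Otherwise the creator of the selected ball is the witness: its uncertainty was small
at the creation and has not grown since. The initial ball has radius `1`, so the trivial bound
suffices. -/
theorem psg_le_charged (hA : 0 ≤ A) (hdiam : ∀ z z' : X × Y, dist z z' ≤ 1)
    (hLip : ∀ (i : Fin d) (z z' : X × Y), |μ z.1 z.2 i - μ z'.1 z'.2 i| ≤ dist z z')
    {t : ℕ} (ht : t < T) (hconf : ¬ (S t).Unconfident A μ) :
    psg μ (x t) (y t) ≤ 14 * (S T).radius (charged A S b t) := by
  have hcover := h.exists_mem_ball hdiam t
  have hadm := h.adm t ht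
  have hr0 : 0 ≤ (S t).radius (b t) := dist_nonneg.trans hadm.2.1
  unfold charged
  split_ifs with hs
  · rw [h.radius_num hs ht]
    have := State.psg_le_of_unc_le hLip hconf hcover hadm hs
    linarith
  · rw [h.radius_eq ht.le (h.lt_num ht)]
    by_cases hb0 : b t = 0
    · rw [hb0, h.radius_zero]
      linarith [psg_le_one hdiam hLip (x t) (y t)]
    · obtain ⟨s, hst, hs', hnum⟩ := h.exists_spawns (h.lt_num ht) hb0
      have hsT := hst.trans ht
      have hbs : b s < (S t).num := (h.lt_num hsT).trans_le (h.num_mono hst.le)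
      have hrad := h.radius_eq hst.le (h.lt_num hsT)
      have hrn := h.radius_num hs' hst
      rw [hnum] at hrn
      refine State.psg_le_of_parent hLip hconf hcover hadm hbs (by rw [hrad, hrn]; ring) ?_ ?_
      · rw [hrad]
        exact State.unc_le_of_count_le hA hs' (h.count_mono hst.le ht.le _)
      · rw [State.ball, hrad, h.center_eq hst.le (h.lt_num hsT), ← hnum, h.center_num hs' hst]
        exact (h.adm s hsT).2.1

/-- One charge comes from the round that creates the ball. In the other charged rounds the
uncertainty exceeds the radius, so the counter is below `2 A / r²`, and it takes distinct values in
distinct rounds. -/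
theorem card_charged_le (hA : 0 < A) {k : ℕ} (hk : 0 < (S T).radius k) :
    (((Finset.range T).filter fun t => charged A S b t = k).card : ℝ) ≤
      2 * A / (S T).radius k ^ 2 + 2 := by
  classical
  set r := (S T).radius k with hr
  set P := (Finset.range T).filter fun t => (S t).Spawns A (b t) ∧ (S t).num = k
  set Q := (Finset.range T).filter fun t => ¬ (S t).Spawns A (b t) ∧ b t = k
  have hsub : ((Finset.range T).filter fun t => charged A S b t = k) ⊆ P ∪ Q := by
    intro t ht
    obtain ⟨ht1, ht2⟩ := Finset.mem_filter.1 ht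
    unfold charged at ht2
    split_ifs at ht2 with hs
    · exact Finset.mem_union_left _ (Finset.mem_filter.2 ⟨ht1, hs, ht2⟩)
    · exact Finset.mem_union_right _ (Finset.mem_filter.2 ⟨ht1, hs, ht2⟩)
  have hP : P.card ≤ 1 := by
    refine Finset.card_le_one.2 fun s hs t ht => ?_
    simp only [P, Finset.mem_filter, Finset.mem_range] at hs ht
    rcases lt_trichotomy s t with hlt | heq | hlt
    · have := h.num_lt_of_spawns hs.2.1 hlt
      omega
    · exact heq
    · have := h.num_lt_of_spawns ht.2.1 hlt
      omega
  have hQ : Q.card ≤ ⌈2 * A / r ^ 2⌉₊ := by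
    rw [← Finset.card_range ⌈2 * A / r ^ 2⌉₊]
    refine Finset.card_le_card_of_injOn (fun t => (S t).count k) ?_ ?_
    · intro t ht
      simp only [Q, Finset.coe_filter, Finset.mem_range, Set.mem_ofPred_eq] at ht
      obtain ⟨ht, hs, rfl⟩ := ht
      simp only [Finset.coe_range, Set.mem_Iio, Nat.lt_ceil]
      rw [State.Spawns, State.unc_le_iff, ← h.radius_eq ht.le (h.lt_num ht), ← hr, not_and,
        not_le] at hs
      by_cases h0 : (S t).count (b t) = 0
      · rw [h0, Nat.cast_zero]
        positivity
      · have hc : (0 : ℝ) < (S t).count (b t) := by exact_mod_cast Nat.pos_of_ne_zero h0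
        have h1 := (Real.lt_sqrt hk.le).1 (hs h0)
        rw [lt_div_iff₀ hc] at h1
        rw [lt_div_iff₀ (by positivity)]
        linarith
    · intro s hs t ht hst
      simp only [Q, Finset.coe_filter, Finset.mem_range, Set.mem_ofPred_eq] at hs ht
      simp only at hst
      rcases lt_trichotomy s t with hlt | heq | hlt
      · have := h.count_lt hlt ht.1.le
        rw [hs.2.2] at this
        omega
      · exact heq
      · have := h.count_lt hlt hs.1.le
        rw [ht.2.2] at this
        omega
  have hQ' : (Q.card : ℝ) ≤ 2 * A / r ^ 2 + 1 := by
    have hpos : 0 ≤ 2 * A / r ^ 2 := by positivity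
    have h1 : (Q.card : ℝ) ≤ (⌈2 * A / r ^ 2⌉₊ : ℝ) := by exact_mod_cast hQ
    linarith [Nat.ceil_lt_add_one hpos]
  have hcard : (((Finset.range T).filter fun t => charged A S b t = k).card : ℝ) ≤
      P.card + Q.card := by
    exact_mod_cast (Finset.card_le_card hsub).trans (Finset.card_union_le _ _)
  have hP' : (P.card : ℝ) ≤ 1 := by exact_mod_cast hP
  linarith

/-- The balls of a given radius have separated centers of small gap. -/
theorem card_radius_le (hdiam : ∀ z z' : X × Y, dist z z' ≤ 1)
    (hLip : ∀ (i : Fin d) (z z' : X × Y), |μ z.1 z.2 i - μ z'.1 z'.2 i| ≤ dist z z')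
    (hconf : ∀ t < T, ¬ (S t).Unconfident A μ) {r : ℝ} (hr0 : 0 < r) (hr1 : r < 1)
    {F : Finset ℕ} (hF : ∀ k ∈ F, k < (S T).num ∧ (S T).radius k = r) :
    (F.card : ℕ∞) ≤ zoomingNumber μ r := by
  have hsp : ∀ k ∈ F, ∃ s < T, (S s).Spawns A (b s) ∧ (S s).num = k := by
    intro k hk
    refine h.exists_spawns (hF k hk).1 fun h0 => ?_
    have := (hF k hk).2
    rw [h0, h.radius_zero] at this
    linarith
  have hsep' : ∀ j ∈ F, ∀ k ∈ F, j < k → r < dist ((S T).center j) ((S T).center k) := by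
    intro j hj k hk hjk
    obtain ⟨s, hsT, hs, rfl⟩ := hsp k hk
    have hrad := (hF _ hk).2
    rw [h.radius_num hs hsT] at hrad
    have hdom := (h.adm s hsT).2.2
    simp only [Set.mem_iUnion, not_exists] at hdom
    have hrj := (hF j hj).2
    rw [h.radius_eq hsT.le hjk] at hrj
    -- The later center was in the domain of a ball of radius `2 r`, hence outside every ball of
    -- radius `r` active then.
    have := hdom j ⟨hjk, by rw [hrj]; linarith⟩
    rw [State.ball, Metric.mem_closedBall, not_le, hrj] at this
    rw [h.center_eq hsT.le hjk, h.center_num hs hsT, dist_comm]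
    exact this
  have hsep : ∀ j ∈ F, ∀ k ∈ F, j ≠ k → r < dist ((S T).center j) ((S T).center k) := by
    intro j hj k hk hne
    rcases lt_or_gt_of_ne hne with hlt | hlt
    · exact hsep' j hj k hk hlt
    · rw [dist_comm]
      exact hsep' k hk j hj hlt
  have hinj : Set.InjOn (S T).center (F : Set ℕ) := by
    intro j hj k hk hjk
    by_contra hne
    have := hsep j hj k hk hne
    rw [hjk, dist_self] at this
    linarith
  have hcard : ((S T).center '' (F : Set ℕ)).encard = (F.card : ℕ∞) := by
    rw [hinj.encard_image, Set.encard_coe_eq_coe_finsetCard]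
  rw [← hcard]
  refine le_iSup₂_of_le (f := fun (C : Set (X × Y)) (_ : C ⊆ {z : X × Y | psg μ z.1 z.2 ≤ 12 * r} ∧
    C.Pairwise fun z z' => r ≤ dist z z') => C.encard) ((S T).center '' (F : Set ℕ)) ⟨?_, ?_⟩ le_rfl
  · rintro _ ⟨k, hk, rfl⟩
    obtain ⟨s, hsT, hs, rfl⟩ := hsp k hk
    have hrad := (hF _ hk).2
    rw [h.radius_num hs hsT] at hrad
    -- The creator has radius `2 r`, so the gap at the new center is at most `6 · 2 r`: the `12` of
    -- the zooming number.
    have := State.psg_le_of_unc_le hLip (hconf s hsT) (h.exists_mem_ball hdiam s) (h.adm s hsT) hs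
    rw [h.center_num hs hsT]
    simp only [Set.mem_ofPred_eq]
    linarith
  · rintro _ ⟨j, hj, rfl⟩ _ ⟨k, hk, rfl⟩ hne
    exact (hsep j hj k hk fun hjk => hne (by rw [hjk])).le

end IsTrajectory
end PCZ

namespace PCZ

/-! ### Consequences of a finite zooming dimension -/

section Zooming

open Filter Topology

variable {X Y : Type*} [PseudoMetricSpace (X × Y)] {d : ℕ} {μ : X → Y → Fin d → ℝ} {p : ℝ}

/-- The infimum defining the dimension is itself an admissible exponent, by continuity of the bound
in the exponent. -/
theorem zoomingNumber_le (hp : 0 ≤ p) (hfin : zoomingDim μ p ≠ ⊤) {r : ℝ} (hr0 : 0 < r)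
    (hr1 : r < 1) :
    (zoomingNumber μ r : ℝ≥0∞) ≤ ENNReal.ofReal (p * r ^ (-(zoomingDim μ p).toReal)) := by
  set D := (zoomingDim μ p).toReal with hD
  have hlarge : ∀ a, D < a → (zoomingNumber μ r : ℝ≥0∞) ≤ ENNReal.ofReal (p * r ^ (-a)) := by
    intro a ha
    have hlt : zoomingDim μ p < ENNReal.ofReal a :=
      (ENNReal.lt_ofReal_iff_toReal_lt hfin).2 ha
    obtain ⟨a', ha1⟩ := iInf_lt_iff.1 hlt
    obtain ⟨ha', hlt'⟩ := iInf_lt_iff.1 ha1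
    have haa : a' ≤ a := ((ENNReal.ofReal_lt_ofReal_iff_of_nonneg ha'.1.le).1 hlt').le
    refine (ha'.2 r hr0 hr1).trans (ENNReal.ofReal_le_ofReal ?_)
    exact mul_le_mul_of_nonneg_left
      (Real.rpow_le_rpow_of_exponent_ge hr0 hr1.le (neg_le_neg haa)) hp
  have hcont : Continuous fun a : ℝ => ENNReal.ofReal (p * r ^ (-a)) := by
    refine ENNReal.continuous_ofReal.comp (continuous_const.mul ?_)
    exact (Real.continuous_const_rpow hr0.ne').comp continuous_neg
  exact ge_of_tendsto ((hcont.tendsto D).mono_left (nhdsWithin_le_nhds (s := Set.Ioi D)))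
    (eventually_nhdsWithin_of_forall hlarge)

theorem card_le_of_le_zoomingNumber (hp : 0 ≤ p) (hfin : zoomingDim μ p ≠ ⊤) {r : ℝ} (hr0 : 0 < r)
    (hr1 : r < 1) {n : ℕ} (hn : (n : ℕ∞) ≤ zoomingNumber μ r) :
    (n : ℝ) ≤ p * r ^ (-(zoomingDim μ p).toReal) := by
  have h1 : ((n : ℕ∞) : ℝ≥0∞) ≤ ENNReal.ofReal (p * r ^ (-(zoomingDim μ p).toReal)) :=
    (ENat.toENNReal_le.2 hn).trans (zoomingNumber_le hp hfin hr0 hr1)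
  have h2 := ENNReal.toReal_mono ENNReal.ofReal_ne_top h1
  rwa [ENNReal.toReal_ofReal (by positivity), ENat.toENNReal_coe, ENNReal.toReal_natCast] at h2

/-- A constant below `1` is too small for packings of radius close to `1`. -/
theorem one_le_of_zoomingDim_ne_top [Nonempty (X × Y)] (hdiam : ∀ z z' : X × Y, dist z z' ≤ 1)
    (hLip : ∀ (i : Fin d) (z z' : X × Y), |μ z.1 z.2 i - μ z'.1 z'.2 i| ≤ dist z z')
    (hp : 0 ≤ p) (hfin : zoomingDim μ p ≠ ⊤) : 1 ≤ p := by
  obtain ⟨z⟩ := ‹Nonempty (X × Y)›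
  set D := (zoomingDim μ p).toReal
  have hlim : Tendsto (fun r : ℝ => p * r ^ (-D)) (𝓝[<] 1) (𝓝 p) := by
    have h1 : ContinuousAt (fun r : ℝ => p * r ^ (-D)) 1 :=
      continuousAt_const.mul (Real.continuousAt_rpow_const _ _ (Or.inl one_ne_zero))
    have h2 := h1.tendsto
    simp only [Real.one_rpow, mul_one] at h2
    exact h2.mono_left nhdsWithin_le_nhds
  refine ge_of_tendsto hlim ?_
  filter_upwards [Ioo_mem_nhdsLT (show (1 / 12 : ℝ) < 1 by norm_num)] with r hr
  have hr0 : 0 < r := lt_trans (by norm_num) hr.1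
  have h1 : ((1 : ℕ) : ℕ∞) ≤ zoomingNumber μ r := by
    refine le_iSup₂_of_le (f := fun (C : Set (X × Y))
      (_ : C ⊆ {z : X × Y | psg μ z.1 z.2 ≤ 12 * r} ∧ C.Pairwise fun z z' => r ≤ dist z z') =>
        C.encard) {z} ⟨?_, Set.pairwise_singleton _ _⟩ (by simp)
    rw [Set.singleton_subset_iff, Set.mem_ofPred_eq]
    linarith [psg_le_one hdiam hLip z.1 z.2, hr.1]
  simpa using card_le_of_le_zoomingNumber hp hfin hr0 hr.2 h1

end Zooming

/-! ### Summation over the levels -/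

theorem sum_range_pow_le {q : ℝ} (hq : 2 ≤ q) (M : ℕ) :
    ∑ l ∈ Finset.range (M + 1), q ^ l ≤ 2 * q ^ M := by
  induction M with
  | zero => simp
  | succ M ih =>
    rw [Finset.sum_range_succ]
    have : 0 ≤ q ^ M * (q - 2) := mul_nonneg (by positivity) (by linarith)
    rw [pow_succ]
    linarith

/-- With `2 ^ M ≤ R < 2 ^ (M + 1)`, rounds at levels above `M` cost at most `14 / R` each, in total
`14 E`. Lower levels cost `28 p (A + 1) q ^ l` with `q = 2 ^ (1 + D) ≥ 2`, a geometric sum of at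
most twice its last term. The choice of `R` makes both `T / R` and `R ^ (1 + D)` equal to `E`. -/
theorem sum_le_of_card_level_le {T : ℕ} (hT : 0 < T) {g : ℕ → ℝ} {lev : ℕ → ℕ} {A p D : ℝ}
    (hA : 0 ≤ A) (hp : 0 ≤ p) (hD : 0 ≤ D)
    (hg : ∀ t < T, g t ≤ 14 * (1 / 2 : ℝ) ^ lev t)
    (hcard : ∀ l, (((Finset.range T).filter fun t => lev t = l).card : ℝ) ≤
      p * ((2 : ℝ) ^ D) ^ l * (2 * A * 4 ^ l + 2)) :
    ∑ t ∈ Finset.range T, g t ≤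
      (14 + 56 * p * (A + 1)) * (T : ℝ) ^ ((1 + D) / (2 + D)) := by
  have hT0 : (0 : ℝ) < T := by exact_mod_cast hT
  have hT1 : (1 : ℝ) ≤ T := by exact_mod_cast hT
  have hD2 : 0 < 2 + D := by linarith
  set R : ℝ := (T : ℝ) ^ (1 / (2 + D)) with hR
  have hR1 : 1 ≤ R := Real.one_le_rpow hT1 (by positivity)
  have hR0 : 0 < R := by linarith
  set E : ℝ := (T : ℝ) ^ ((1 + D) / (2 + D)) with hE
  have hRE : R ^ (1 + D) = E := by
    rw [hR, hE, ← Real.rpow_mul hT0.le]; congr 1; ring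
  have hTE : T * R⁻¹ = E := by
    rw [hR, hE, ← Real.rpow_neg hT0.le]
    nth_rewrite 1 [← Real.rpow_one (T : ℝ)]
    rw [← Real.rpow_add hT0]
    congr 1
    field_simp
    ring
  obtain ⟨M, hM1, hM2⟩ := exists_nat_pow_near hR1 (show (1 : ℝ) < 2 by norm_num)
  have hround : ∀ t ∈ Finset.range T, g t ≤ 14 * R⁻¹ +
      ∑ l ∈ Finset.range (M + 1), if lev t = l then 14 * (1 / 2 : ℝ) ^ l else 0 := by
    intro t ht
    refine (hg t (Finset.mem_range.1 ht)).trans ?_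
    rw [Finset.sum_ite_eq]
    split_ifs with hl
    · have : 0 < R⁻¹ := by positivity
      linarith
    · rw [Finset.mem_range, not_lt] at hl
      have h1 : R ≤ 2 ^ lev t := hM2.le.trans (pow_le_pow_right₀ (by norm_num) hl)
      have h2 : (1 / 2 : ℝ) ^ lev t ≤ R⁻¹ := by
        rw [one_div, inv_pow]
        exact inv_anti₀ hR0 h1
      linarith
  set q : ℝ := 2 ^ (1 + D) with hq
  have hq2 : 2 ≤ q := by
    rw [hq]
    nth_rewrite 1 [← Real.rpow_one (2 : ℝ)]
    exact Real.rpow_le_rpow_of_exponent_le (by norm_num) (by linarith)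
  have hqw : q = 2 * 2 ^ D := by rw [hq, Real.rpow_add (by norm_num), Real.rpow_one]
  have hlevel : ∀ l ∈ Finset.range (M + 1),
      (∑ t ∈ Finset.range T, if lev t = l then 14 * (1 / 2 : ℝ) ^ l else 0) ≤
        28 * p * (A + 1) * q ^ l := by
    intro l _
    rw [← Finset.sum_filter, Finset.sum_const, nsmul_eq_mul]
    have h4 : (1 : ℝ) ≤ 4 ^ l := one_le_pow₀ (by norm_num)
    have h42 : (4 : ℝ) ^ l * (1 / 2) ^ l = 2 ^ l := by rw [← mul_pow]; norm_num
    calc _ ≤ p * ((2 : ℝ) ^ D) ^ l * (2 * A * 4 ^ l + 2) * (14 * (1 / 2 : ℝ) ^ l) := by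
          gcongr; exact hcard l
      _ ≤ p * ((2 : ℝ) ^ D) ^ l * (2 * A * 4 ^ l + 2 * 4 ^ l) * (14 * (1 / 2 : ℝ) ^ l) := by
          gcongr; linarith
      _ = 28 * p * (A + 1) * ((2 : ℝ) ^ D) ^ l * ((4 : ℝ) ^ l * (1 / 2) ^ l) := by ring
      _ = 28 * p * (A + 1) * q ^ l := by rw [h42, hqw, mul_pow]; ring
  have hqM : q ^ M ≤ E := by
    rw [← hRE, hq, ← Real.rpow_natCast, ← Real.rpow_mul (by norm_num), mul_comm,
      Real.rpow_mul (by norm_num), Real.rpow_natCast]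
    exact Real.rpow_le_rpow (by positivity) hM1 (by positivity)
  calc ∑ t ∈ Finset.range T, g t
      ≤ ∑ t ∈ Finset.range T, (14 * R⁻¹ +
          ∑ l ∈ Finset.range (M + 1), if lev t = l then 14 * (1 / 2 : ℝ) ^ l else 0) :=
        Finset.sum_le_sum hround
    _ = 14 * (T * R⁻¹) + ∑ l ∈ Finset.range (M + 1),
          ∑ t ∈ Finset.range T, if lev t = l then 14 * (1 / 2 : ℝ) ^ l else 0 := by
        rw [Finset.sum_add_distrib, Finset.sum_comm, Finset.sum_const, Finset.card_range,
          nsmul_eq_mul]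
        ring
    _ ≤ 14 * E + ∑ l ∈ Finset.range (M + 1), 28 * p * (A + 1) * q ^ l := by
        rw [hTE]
        gcongr with l hl
        exact hlevel l hl
    _ ≤ 14 * E + 28 * p * (A + 1) * (2 * q ^ M) := by
        rw [← Finset.mul_sum]
        gcongr
        exact sum_range_pow_le hq2 M
    _ ≤ 14 * E + 28 * p * (A + 1) * (2 * E) := by gcongr
    _ = (14 + 56 * p * (A + 1)) * E := by ring

/-! ### Regret of a trajectory without failing confidence intervals -/

theorem regret_le_natCast {X Y : Type*} {d : ℕ} [PseudoMetricSpace (X × Y)]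
    {μ : X → Y → Fin d → ℝ} (hdiam : ∀ z z' : X × Y, dist z z' ≤ 1)
    (hLip : ∀ (i : Fin d) (z z' : X × Y), |μ z.1 z.2 i - μ z'.1 z'.2 i| ≤ dist z z')
    (x : ℕ → X) (y : ℕ → Y) (T : ℕ) : regret μ x y T ≤ T := by
  refine (Finset.sum_le_card_nsmul _ _ 1 fun t _ => psg_le_one hdiam hLip _ _).trans ?_
  simp

theorem IsTrajectory.regret_le {X Y : Type*} {d : ℕ} [PseudoMetricSpace (X × Y)] {A : ℝ}
    {z₀ : X × Y} {x : ℕ → X} {y : ℕ → Y} {b : ℕ → ℕ} {rew : ℕ → Fin d → ℝ}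
    {S : ℕ → State X Y d} {T : ℕ} {μ : X → Y → Fin d → ℝ}
    (h : IsTrajectory A z₀ x y b rew S T) (hT : 0 < T) (hA : 0 < A)
    (hdiam : ∀ z z' : X × Y, dist z z' ≤ 1)
    (hLip : ∀ (i : Fin d) (z z' : X × Y), |μ z.1 z.2 i - μ z'.1 z'.2 i| ≤ dist z z')
    (hconf : ∀ t < T, ¬ (S t).Unconfident A μ) {p : ℝ} (hp : 0 < p) :
    regret μ x y T ≤
      (14 + 56 * p * (A + 1)) * (T : ℝ) ^ regretExponent (zoomingDim μ p) := by
  by_cases hfin : zoomingDim μ p = ⊤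
  · rw [regretExponent, if_pos hfin, Real.rpow_one]
    refine (regret_le_natCast hdiam hLip x y T).trans ?_
    refine le_mul_of_one_le_left (Nat.cast_nonneg T) ?_
    have : 0 ≤ 56 * p * (A + 1) := by positivity
    linarith
  rw [regretExponent, if_neg hfin]
  have : Nonempty (X × Y) := ⟨z₀⟩
  have hp1 := one_le_of_zoomingDim_ne_top hdiam hLip hp.le hfin
  -- The level of an inactive number is arbitrary; only active balls are charged.
  have hlev : ∀ k, ∃ l : ℕ, k < (S T).num → (S T).radius k = (1 / 2 : ℝ) ^ l ∧ (l = 0 → k = 0) := by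
    intro k
    by_cases hk : k < (S T).num
    · obtain ⟨l, hl⟩ := h.exists_radius_eq le_rfl hk
      exact ⟨l, fun _ => hl⟩
    · exact ⟨0, fun hk' => absurd hk' hk⟩
  choose lev hlev using hlev
  refine sum_le_of_card_level_le hT (lev := fun t => lev (IsTrajectory.charged A S b t)) hA.le hp.le
    ENNReal.toReal_nonneg ?_ fun l => ?_
  · intro t ht
    rw [← (hlev _ (h.charged_lt ht)).1]
    exact h.psg_le_charged hA.le hdiam hLip ht (hconf t ht)
  set F := (Finset.range (S T).num).filter fun k => lev k = l with hF
  have hFk : ∀ k ∈ F, k < (S T).num ∧ (S T).radius k = (1 / 2 : ℝ) ^ l := by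
    intro k hk
    simp only [hF, Finset.mem_filter, Finset.mem_range] at hk
    obtain ⟨hk, rfl⟩ := hk
    exact ⟨hk, (hlev k hk).1⟩
  have hFcard : (F.card : ℝ) ≤ p * ((2 : ℝ) ^ (zoomingDim μ p).toReal) ^ l := by
    -- Radius `1` is outside the range of the zooming bound; there is just one such ball, and `1 ≤
    -- p` covers it.
    by_cases hl : l = 0
    · have : F.card ≤ 1 := by
        refine Finset.card_le_one.2 fun j hj k hk => ?_
        simp only [hF, Finset.mem_filter, Finset.mem_range] at hj hk
        rw [(hlev j hj.1).2 (by omega), (hlev k hk.1).2 (by omega)]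
      have : (F.card : ℝ) ≤ 1 := by exact_mod_cast this
      rw [hl, pow_zero, mul_one]
      exact this.trans hp1
    · have hr0 : (0 : ℝ) < (1 / 2) ^ l := by positivity
      have hr1 : (1 / 2 : ℝ) ^ l < 1 := pow_lt_one₀ (by norm_num) (by norm_num) hl
      have h1 := card_le_of_le_zoomingNumber hp.le hfin hr0 hr1
        (h.card_radius_le hdiam hLip hconf hr0 hr1 hFk)
      rwa [one_div, inv_pow, Real.inv_rpow (by positivity), Real.rpow_neg (by positivity), inv_inv,
        ← Real.rpow_natCast, ← Real.rpow_mul (by norm_num), mul_comm (l : ℝ),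
        Real.rpow_mul (by norm_num), Real.rpow_natCast] at h1
  have hfib : ((Finset.range T).filter fun t => lev (IsTrajectory.charged A S b t) = l).card ≤
      ∑ k ∈ F, ((Finset.range T).filter fun t => IsTrajectory.charged A S b t = k).card := by
    rw [Finset.card_eq_sum_card_fiberwise (f := IsTrajectory.charged A S b) (t := F)]
    · exact Finset.sum_le_sum fun k _ => Finset.card_le_card
        (Finset.filter_subset_filter _ (Finset.filter_subset _ _))
    · intro t ht
      simp only [Finset.coe_filter, Finset.mem_range, Set.mem_ofPred_eq] at ht
      simp only [hF, Finset.coe_filter, Finset.mem_range, Set.mem_ofPred_eq]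
      exact ⟨h.charged_lt ht.1, ht.2⟩
  have hsum : ∀ k ∈ F,
      (((Finset.range T).filter fun t => IsTrajectory.charged A S b t = k).card : ℝ) ≤
        2 * A * 4 ^ l + 2 := by
    intro k hk
    have hr := (hFk k hk).2
    have h1 := h.card_charged_le hA (k := k) (by rw [hr]; positivity)
    have h2 : 2 * A / ((1 / 2 : ℝ) ^ l) ^ 2 = 2 * A * 4 ^ l := by
      rw [← pow_mul, mul_comm l, pow_mul, div_eq_mul_inv, ← inv_pow]
      norm_num
    rwa [hr, h2] at h1
  calc _ ≤ ∑ k ∈ F,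
        (((Finset.range T).filter fun t => IsTrajectory.charged A S b t = k).card : ℝ) := by
        exact_mod_cast hfib
    _ ≤ F.card * (2 * A * 4 ^ l + 2) := by
        rw [← nsmul_eq_mul]
        exact Finset.sum_le_card_nsmul _ _ _ hsum
    _ ≤ _ := by gcongr

/-! ### The confidence parameter -/

section ConfA

variable {d T : ℕ} {δ : ℝ}

theorem one_le_log_arg (hd : 0 < d) (hT : 0 < T) (hδ0 : 0 < δ) (hδ1 : δ < 1) :
    1 ≤ 2 * Real.sqrt 2 * d * (T : ℝ) ^ (3 / 2 : ℝ) / δ := by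
  have hd1 : (1 : ℝ) ≤ d := by exact_mod_cast hd
  have hT1 : (1 : ℝ) ≤ (T : ℝ) ^ (3 / 2 : ℝ) :=
    Real.one_le_rpow (by exact_mod_cast hT) (by norm_num)
  have hs : 1 ≤ Real.sqrt 2 := Real.one_le_sqrt.2 (by norm_num)
  rw [le_div_iff₀ hδ0, one_mul]
  have h1 : 1 ≤ 2 * Real.sqrt 2 := by linarith
  exact hδ1.le.trans (one_le_mul_of_one_le_of_one_le (one_le_mul_of_one_le_of_one_le h1 hd1) hT1)

theorem confA_pos (hd : 0 < d) (hT : 0 < T) (hδ0 : 0 < δ) (hδ1 : δ < 1) : 0 < confA d T δ := by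
  have := Real.log_nonneg (one_le_log_arg hd hT hδ0 hδ1)
  rw [confA]
  linarith

theorem confA_add_one (hd : 0 < d) (hT : 0 < T) (hδ0 : 0 < δ) (hδ1 : δ < 1) :
    confA d T δ + 1 =
      2 * Real.log (2 * Real.sqrt 2 * d * (T : ℝ) ^ (3 / 2 : ℝ) * Real.exp 1 / δ) := by
  have h1 : 0 < 2 * Real.sqrt 2 * d * (T : ℝ) ^ (3 / 2 : ℝ) / δ :=
    lt_of_lt_of_le one_pos (one_le_log_arg hd hT hδ0 hδ1)
  rw [mul_div_right_comm, Real.log_mul h1.ne' (Real.exp_pos 1).ne', Real.log_exp, confA]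
  ring

/-- Here `exp A = e q²` with `q² = 8 d² T³ / δ²`, while `(T + 1)³ ≤ 8 T³`; the quotient is at most
`2 δ² / e ≤ δ`. -/
theorem card_mul_exp_neg_confA_le (hd : 0 < d) (hT : 0 < T) (hδ0 : 0 < δ) (hδ1 : δ < 1) :
    (((T + 1) * ((T + 1) * ((T + 1) * (d * 2))) : ℕ) : ℝ) * Real.exp (-confA d T δ) ≤ δ := by
  have hT0 : (0 : ℝ) < T := by exact_mod_cast hT
  have hT1 : (1 : ℝ) ≤ T := by exact_mod_cast hT
  have hd1 : (1 : ℝ) ≤ d := by exact_mod_cast hd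
  set q := 2 * Real.sqrt 2 * d * (T : ℝ) ^ (3 / 2 : ℝ) / δ with hq
  have hq1 : 1 ≤ q := one_le_log_arg hd hT hδ0 hδ1
  have hq0 : 0 < q := by linarith
  have hq2 : q ^ 2 * δ ^ 2 = 8 * d ^ 2 * T ^ 3 := by
    have h1 : q * δ = 2 * Real.sqrt 2 * d * (T : ℝ) ^ (3 / 2 : ℝ) := by rw [hq]; field_simp
    have h2 : ((T : ℝ) ^ (3 / 2 : ℝ)) ^ 2 = T ^ 3 := by
      rw [← Real.rpow_natCast, ← Real.rpow_mul hT0.le, ← Real.rpow_natCast]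
      norm_num
    rw [← mul_pow, h1, mul_pow, mul_pow, mul_pow, h2, Real.sq_sqrt (by norm_num)]
    ring
  have hexp : Real.exp (confA d T δ) = Real.exp 1 * q ^ 2 := by
    rw [confA, Real.exp_add, two_mul, Real.exp_add, Real.exp_log hq0, sq]
  rw [Real.exp_neg, ← div_eq_mul_inv, div_le_iff₀ (Real.exp_pos _), hexp]
  have he : (2 : ℝ) ≤ Real.exp 1 := by linarith [Real.add_one_le_exp (1 : ℝ)]
  have hT3 : ((T : ℝ) + 1) ^ 3 ≤ 8 * (T : ℝ) ^ 3 := by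
    calc ((T : ℝ) + 1) ^ 3 ≤ (2 * (T : ℝ)) ^ 3 := by gcongr; linarith
      _ = 8 * (T : ℝ) ^ 3 := by ring
  push_cast
  calc ((T : ℝ) + 1) * ((T + 1) * ((T + 1) * (d * 2))) = (T + 1) ^ 3 * (2 * d) := by ring
    _ ≤ 8 * T ^ 3 * (2 * d ^ 2) := by gcongr; nlinarith
    _ = 2 * (q ^ 2 * δ ^ 2) := by rw [hq2]; ring
    _ ≤ Real.exp 1 * (q ^ 2 * δ) := by gcongr; nlinarith
    _ = δ * (Real.exp 1 * q ^ 2) := by ring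

end ConfA

end PCZ

/-! ### Union bound and conclusion -/

theorem theorem1 {Ω X Y : Type*} [MeasurableSpace Ω] (P : Measure Ω) [IsProbabilityMeasure P]
    [MeasurableSpace X] [MeasurableSpace Y] [PseudoMetricSpace (X × Y)]
    (d T : ℕ) (hd : 0 < d) (hT : 0 < T) (δ : ℝ) (hδ0 : 0 < δ) (hδ1 : δ < 1)
    -- similarity information
    (μ : X → Y → Fin d → ℝ)
    (hdiam : ∀ z z' : X × Y, dist z z' ≤ 1)
    (hLip : ∀ (i : Fin d) (z z' : X × Y), |μ z.1 z.2 i - μ z'.1 z'.2 i| ≤ dist z z')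
    -- center of the initial ball, contexts, selected arms, selected balls, noise
    (z₀ : Ω → X × Y) (x : ℕ → Ω → X) (y : ℕ → Ω → Y) (b : ℕ → Ω → ℕ) (κ : ℕ → Ω → Fin d → ℝ)
    (hx : ∀ t, Measurable (x t)) (hy : ∀ t, Measurable (y t)) (hb : ∀ t, Measurable (b t))
    (hκ : ∀ t, Measurable (κ t))
    (hnoise : ∀ t < T, ∀ i : Fin d,
      PCZ.CondSubGaussian (PCZ.history x y b κ t) P (fun ω => κ t ω i))
    -- `S t ω` is the state of the algorithm after `t` rounds
    (S : ℕ → Ω → PCZ.State X Y d)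
    (hS : ∀ t ω, S t ω = PCZ.run (PCZ.confA d T δ) μ (z₀ ω) (fun s => x s ω) (fun s => y s ω)
      (fun s => b s ω) (fun s => κ s ω) t)
    -- in every round the arm and the ball are selected as the algorithm prescribes
    (hsel : ∀ᵐ ω ∂P, ∀ t < T,
      (S t ω).Admissible (PCZ.confA d T δ) (x t ω) (y t ω) (b t ω)) :
    -- the event that some confidence interval fails has probability at most `δ`
    P {ω | ∃ t ≤ T, (S t ω).Unconfident (PCZ.confA d T δ) μ} ≤ ENNReal.ofReal δ ∧
    -- and off this event the regret is bounded, for every `p > 0`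
    ∀ᵐ ω ∂P, (¬ ∃ t ≤ T, (S t ω).Unconfident (PCZ.confA d T δ) μ) → ∀ p : ℝ, 0 < p →
      PCZ.regret μ (fun s => x s ω) (fun s => y s ω) T ≤
        (28 + 112 * p *
            Real.log (2 * Real.sqrt 2 * d * (T : ℝ) ^ (3 / 2 : ℝ) * Real.exp 1 / δ)) *
          (T : ℝ) ^ PCZ.regretExponent (PCZ.zoomingDim μ p) := by
  classical
  have hA := PCZ.confA_pos hd hT hδ0 hδ1
  have htraj : ∀ᵐ ω ∂P, PCZ.IsTrajectory (PCZ.confA d T δ) (z₀ ω) (fun s => x s ω)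
      (fun s => y s ω) (fun s => b s ω) (fun s i => μ (x s ω) (y s ω) i + κ s ω i)
      (fun s => S s ω) T := by
    filter_upwards [hsel] with ω hω
    exact ⟨by rw [hS]; rfl, fun t => by rw [hS, hS]; rfl, hω⟩
  refine ⟨?_, ?_⟩
  · let E : ℕ × ℕ × ℕ × Fin d × ℝ → Set Ω := fun j => {ω | j.2.2.1 ≠ 0 ∧
      ((Finset.range j.1).filter fun s => b s ω = j.2.1).card = j.2.2.1 ∧
      Real.sqrt (2 * PCZ.confA d T δ * j.2.2.1) ≤
        j.2.2.2.2 * ∑ s ∈ Finset.range j.1 with b s ω = j.2.1, κ s ω j.2.2.2.1}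
    let I : Finset (ℕ × ℕ × ℕ × Fin d × ℝ) := Finset.range (T + 1) ×ˢ Finset.range (T + 1) ×ˢ
      Finset.range (T + 1) ×ˢ Finset.univ ×ˢ {1, -1}
    have hcard : I.card = (T + 1) * ((T + 1) * ((T + 1) * (d * 2))) := by
      have h2 : ({1, -1} : Finset ℝ).card = 2 := Finset.card_pair (by norm_num)
      simp [I, h2]
    -- The inclusion holds only almost surely, since the selections are admissible only almost
    -- surely.
    have hsub : {ω | ∃ t ≤ T, (S t ω).Unconfident (PCZ.confA d T δ) μ} ≤ᵐ[P]
        ⋃ j ∈ I, E j := by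
      filter_upwards [htraj] with ω hω
      rintro ⟨t, ht, hun⟩
      obtain ⟨k, hk, n, hn, i, σ, hσ, h⟩ := hω.exists_noise_of_unconfident hLip ht hun
      refine Set.mem_iUnion₂.2 ⟨(t, k, n, i, σ), ?_, h⟩
      simp only [I, Finset.mem_product, Finset.mem_range, Finset.mem_univ, true_and]
      exact ⟨by omega, by omega, by omega, hσ⟩
    have hE : ∀ j ∈ I, P (E j) ≤ ENNReal.ofReal (Real.exp (-PCZ.confA d T δ)) := by
      rintro ⟨t, k, n, i, σ⟩ hj
      simp only [I, Finset.mem_product, Finset.mem_range] at hj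
      have hσ : σ ^ 2 = 1 := by
        have := hj.2.2.2.2
        simp only [Finset.mem_insert, Finset.mem_singleton] at this
        rcases this with rfl | rfl <;> norm_num
      exact PCZ.measure_noise_sum_ge_le P hx hy hb hκ i (fun t ht => hnoise t ht i) hA.le hσ k n
        (by omega)
    calc P {ω | ∃ t ≤ T, (S t ω).Unconfident (PCZ.confA d T δ) μ}
        ≤ P (⋃ j ∈ I, E j) := measure_mono_ae hsub
      _ ≤ ∑ j ∈ I, P (E j) := measure_biUnion_finset_le I E
      _ ≤ I.card * ENNReal.ofReal (Real.exp (-PCZ.confA d T δ)) := by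
          rw [← nsmul_eq_mul]
          exact Finset.sum_le_card_nsmul I _ _ hE
      _ = ENNReal.ofReal ((I.card : ℝ) * Real.exp (-PCZ.confA d T δ)) := by
          rw [ENNReal.ofReal_mul (Nat.cast_nonneg _), ENNReal.ofReal_natCast]
      _ ≤ ENNReal.ofReal δ := by
          rw [hcard]
          exact ENNReal.ofReal_le_ofReal (PCZ.card_mul_exp_neg_confA_le hd hT hδ0 hδ1)
  · filter_upwards [htraj] with ω hω hconf p hp
    refine (hω.regret_le hT hA hdiam hLip (fun t ht hun => hconf ⟨t, ht.le, hun⟩) hp).trans ?_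
    refine mul_le_mul_of_nonneg_right ?_ (Real.rpow_nonneg (Nat.cast_nonneg T) _)
    -- `A + 1` is twice the logarithm, turning `56` into `112`; the additive `14` is relaxed to
    -- `28`.
    rw [PCZ.confA_add_one hd hT hδ0 hδ1]
    linarith
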